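/- Let $d\ge 2$, let $\Omega\subset\mathbb{R}^d$ be a nonempty bounded connected open set, and let $\varphi\in C(\partial\Omega)$. A *classical solution* of the Dirichlet problem $D(\varphi)$ is a function $u\in C(\overline\Omega)$ which is harmonic on $\Omega$ and satisfies $u|_{\partial\Omega}=\varphi$. Let $H^1_0(\Omega)$ be the closure of $C_c^\infty(\Omega)$ in $H^1(\Omega)$. An *admissible extension* of $\varphi$ is a function $\Phi\in C(\overline\Omega)$ with $\Phi|_{\partial\Omega}=\varphi$ and $\Delta\Phi\in H^{-1}(\Omega)$, i.e. such that for some $M\ge 0$ $$\Bigl|\int_\Omega \Phi\,\Delta w\,dx\Bigr|\le M\,\|w\|_{H^1(\Omega)}\qquad\text{for all } w\in C_c^\infty(\Omega).$$ A harmonic function $h$ on $\Omega$ is *the function produced by* $\Phi$ if $h=\Phi-v$ almost everywhere on $\Omega$, where $v\in H^1_0(\Omega)$ satisfies $$\int_\Omega \Phi\,\Delta w\,dx=-\int_\Omega\nabla v\cdot\nabla w\,dx\qquad\text{for all } w\in C_c^\infty(\Omega).$$ A *variational solution* of $D(\varphi)$ is a harmonic function on $\Omega$ produced by some admissible extension of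 $\varphi$. **Proposition.** Suppose that $D(\varphi)$ has a classical solution $u$. Then $u$ is equal on $\Omega$ to the variational solution $u_\varphi$ of $D(\varphi)$. That is, $u|_\Omega$ is a variational solution of $D(\varphi)$, it is the function produced by every admissible extension of $\varphi$, and every variational solution of $D(\varphi)$ coincides with $u$ on $\Omega$. -/

import Mathlib

open MeasureTheory Filter Topology
open scoped Distributions Laplacian Gradient

/-- `G` is the weak (distributional) gradient of `v` on `Ω`. It is only used below for
`v` and `G` square integrable on `Ω`, so that all the integrals converge. -/
def HasWeakGradient {d : ℕ} (Ω : TopologicalSpace.Opens (EuclideanSpace ℝ (Fin d)))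
    (v : EuclideanSpace ℝ (Fin d) → ℝ)
    (G : EuclideanSpace ℝ (Fin d) → EuclideanSpace ℝ (Fin d)) : Prop :=
  ∀ (w : 𝓓(Ω, ℝ)) (j : Fin d),
    ∫ x in (Ω : Set (EuclideanSpace ℝ (Fin d))), v x * (∇ w x) j
      = -∫ x in (Ω : Set (EuclideanSpace ℝ (Fin d))), (G x) j * w x

/-- `v` belongs to the Sobolev space `H¹(Ω)` and `G` is its weak gradient. -/
structure IsH1 {d : ℕ} (Ω : TopologicalSpace.Opens (EuclideanSpace ℝ (Fin d)))
    (v : EuclideanSpace ℝ (Fin d) → ℝ)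
    (G : EuclideanSpace ℝ (Fin d) → EuclideanSpace ℝ (Fin d)) : Prop where
  memLp : MemLp v 2 (volume.restrict Ω)
  memLp_grad : MemLp G 2 (volume.restrict Ω)
  hasWeakGradient : HasWeakGradient Ω v G

/-- `v` belongs to `H¹₀(Ω)`, the closure of the test functions in `H¹(Ω)`, and `G` is its weak
gradient: `v` and `G` are the `L²` limits of `wₙ` and `∇ wₙ` for some test functions `wₙ`. -/
structure IsH10 {d : ℕ} (Ω : TopologicalSpace.Opens (EuclideanSpace ℝ (Fin d)))
    (v : EuclideanSpace ℝ (Fin d) → ℝ)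
    (G : EuclideanSpace ℝ (Fin d) → EuclideanSpace ℝ (Fin d)) : Prop extends IsH1 Ω v G where
  exists_approx : ∃ w : ℕ → 𝓓(Ω, ℝ),
    Tendsto (fun n => eLpNorm (fun x => v x - w n x) 2 (volume.restrict Ω)) atTop (𝓝 0) ∧
    Tendsto (fun n => eLpNorm (fun x => G x - ∇ (w n) x) 2 (volume.restrict Ω)) atTop (𝓝 0)

/-- The `H¹(Ω)` norm of a test function. -/
noncomputable def testH1Norm {d : ℕ} (Ω : TopologicalSpace.Opens (EuclideanSpace ℝ (Fin d)))
    (w : 𝓓(Ω, ℝ)) : ℝ :=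
  Real.sqrt ((∫ x in (Ω : Set (EuclideanSpace ℝ (Fin d))), w x ^ 2)
    + ∫ x in (Ω : Set (EuclideanSpace ℝ (Fin d))), ‖∇ w x‖ ^ 2)

/-- The distributional Laplacian of `Φ` lies in `H⁻¹(Ω)`, that is, it is bounded on the
test functions for the `H¹(Ω)` norm. -/
def LaplacianMemHNegOne {d : ℕ} (Ω : TopologicalSpace.Opens (EuclideanSpace ℝ (Fin d)))
    (Φ : EuclideanSpace ℝ (Fin d) → ℝ) : Prop :=
  ∃ M : ℝ, 0 ≤ M ∧ ∀ w : 𝓓(Ω, ℝ),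
    |∫ x in (Ω : Set (EuclideanSpace ℝ (Fin d))), Φ x * (Δ (w : EuclideanSpace ℝ (Fin d) → ℝ)) x|
      ≤ M * testH1Norm Ω w

/-- `Φ` is an extension in `C(closure Ω)` of the boundary function `φ` with `ΔΦ ∈ H⁻¹(Ω)`.
Only the values of `Φ` on `closure Ω` matter. -/
structure IsAdmissibleExtension {d : ℕ}
    (Ω : TopologicalSpace.Opens (EuclideanSpace ℝ (Fin d)))
    (φ : C(frontier (Ω : Set (EuclideanSpace ℝ (Fin d))), ℝ))
    (Φ : EuclideanSpace ℝ (Fin d) → ℝ) : Prop where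
  continuousOn : ContinuousOn Φ (closure (Ω : Set (EuclideanSpace ℝ (Fin d))))
  boundary : ∀ z : frontier (Ω : Set (EuclideanSpace ℝ (Fin d))), Φ z = φ z
  laplacian : LaplacianMemHNegOne Ω Φ

/-- `h` is the harmonic function on `Ω` produced by the variational construction from `Φ`:
`h = Φ - v` almost everywhere on `Ω`, where `v ∈ H¹₀(Ω)` is the function with
`∫_Ω Φ Δw = -∫_Ω ∇v · ∇w` for all test functions `w`. -/
def IsVariationalSolutionFrom {d : ℕ}
    (Ω : TopologicalSpace.Opens (EuclideanSpace ℝ (Fin d)))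
    (Φ h : EuclideanSpace ℝ (Fin d) → ℝ) : Prop :=
  InnerProductSpace.HarmonicOnNhd h (Ω : Set (EuclideanSpace ℝ (Fin d))) ∧
  ∃ (v : EuclideanSpace ℝ (Fin d) → ℝ)
    (G : EuclideanSpace ℝ (Fin d) → EuclideanSpace ℝ (Fin d)),
    IsH10 Ω v G ∧
    (∀ w : 𝓓(Ω, ℝ),
      ∫ x in (Ω : Set (EuclideanSpace ℝ (Fin d))),
          Φ x * (Δ (w : EuclideanSpace ℝ (Fin d) → ℝ)) x
        = -∫ x in (Ω : Set (EuclideanSpace ℝ (Fin d))), inner ℝ (G x) (∇ w x)) ∧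
    ∀ᵐ x ∂(volume.restrict (Ω : Set (EuclideanSpace ℝ (Fin d)))), h x = Φ x - v x

/-- `h` is a variational solution of the Dirichlet problem `D(φ)` on `Ω`: it is produced by the
variational construction from some admissible extension of `φ`. -/
def IsVariationalSolution {d : ℕ}
    (Ω : TopologicalSpace.Opens (EuclideanSpace ℝ (Fin d)))
    (φ : C(frontier (Ω : Set (EuclideanSpace ℝ (Fin d))), ℝ))
    (h : EuclideanSpace ℝ (Fin d) → ℝ) : Prop :=
  ∃ Φ : EuclideanSpace ℝ (Fin d) → ℝ,
    IsAdmissibleExtension Ω φ Φ ∧ IsVariationalSolutionFrom Ω Φ h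

/-- `u` is a classical solution of `D(φ)`: it is continuous on `closure Ω`, harmonic on `Ω`, and
equal to `φ` on the boundary. -/
structure IsClassicalSolution {d : ℕ}
    (Ω : TopologicalSpace.Opens (EuclideanSpace ℝ (Fin d)))
    (φ : C(frontier (Ω : Set (EuclideanSpace ℝ (Fin d))), ℝ))
    (u : EuclideanSpace ℝ (Fin d) → ℝ) : Prop where
  continuousOn : ContinuousOn u (closure (Ω : Set (EuclideanSpace ℝ (Fin d))))
  harmonic : InnerProductSpace.HarmonicOnNhd u (Ω : Set (EuclideanSpace ℝ (Fin d)))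
  boundary : ∀ z : frontier (Ω : Set (EuclideanSpace ℝ (Fin d))), u z = φ z

/-! Fix an admissible extension `Φ` and let `v` be `Φ - u` on `Ω`, extended by zero. Since the
boundary values agree, `v` is continuous with compact support; since `u` is weakly harmonic, `v` and
`Φ` have the same distributional Laplacian. Everything reduces to showing `v ∈ H¹₀(Ω)`
(`exists_isH10_of_continuous`); Green's identity then passes to the limit from test functions to
`v`.

The approximants are `w = F ∘ (ρ * v)`, where `ρ` is a mollifier and `F` a smooth soft threshold
with `0 ≤ F' ≤ 1` (`exists_testFunction_approx`). Thresholding keeps the support of `w` inside `{|v|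
≥ ε/2}`, a compact subset of `Ω`. Because `F'² ≤ F'`, `∫ |∇w|² ≤ ∫ ∇(ρ * v) · ∇w = -∫ (ρ * v) Δw ≤ M
‖w‖`, the last step because `ρ * v` tested against `Δw` averages `v` tested against Laplacians of
translates of `w`. As the `w` converge uniformly to `v` and `Ω` has finite volume, they are bounded
in `H¹`, and weak compactness puts `v` in `H¹₀(Ω)` (`exists_isH10_of_tendsto_of_bounded`).

For uniqueness, Poincaré's inequality determines the `H¹₀` function attached to a given `Φ` almost
everywhere. A variational solution coming from `Φ` therefore agrees with `u`, which comes from the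
same `Φ`. -/

/-! ### Green's identities and Poincaré's inequality for compactly supported functions. -/

section IntegrationByParts

variable {E : Type*} [NormedAddCommGroup E] [InnerProductSpace ℝ E]

theorem ContinuousOn.continuous_mul_of_tsupport_subset {X : Type*} [TopologicalSpace X]
    {U : Set X} (hU : IsOpen U)
    {f g : X → ℝ} (hf : ContinuousOn f U) (hg : Continuous g) (hgU : tsupport g ⊆ U) :
    Continuous fun x => f x * g x := by
  refine continuous_of_tsupport fun x hx => ?_
  have hxU : x ∈ U := hgU (tsupport_mul_subset_right hx)
  exact (hf.continuousAt (hU.mem_nhds hxU)).mul hg.continuousAt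

theorem ContinuousOn.integrable_mul_of_tsupport_subset {X : Type*} [TopologicalSpace X]
    [MeasurableSpace X] [OpensMeasurableSpace X] {μ : Measure X} [IsFiniteMeasureOnCompacts μ]
    {U : Set X} (hU : IsOpen U) {f g : X → ℝ} (hf : ContinuousOn f U) (hg : Continuous g)
    (hgc : HasCompactSupport g) (hgU : tsupport g ⊆ U) :
    Integrable (fun x => f x * g x) μ :=
  (hf.continuous_mul_of_tsupport_subset hU hg hgU).integrable_of_hasCompactSupport hgc.mul_left

theorem tsupport_fderiv_apply_subset' (g : E → ℝ) (e : E) :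
    tsupport (fun x => fderiv ℝ g x e) ⊆ tsupport g :=
  tsupport_fderiv_apply_subset ℝ e

theorem ContDiffOn.continuousOn_fderiv_apply {U : Set E} (hU : IsOpen U) {f : E → ℝ}
    (hf : ContDiffOn ℝ 1 f U) (e : E) : ContinuousOn (fun x => fderiv ℝ f x e) U :=
  (hf.continuousOn_fderiv_of_isOpen hU le_rfl).clm_apply continuousOn_const

theorem ContDiffOn.contDiffOn_fderiv_apply {U : Set E} (hU : IsOpen U) {f : E → ℝ}
    (hf : ContDiffOn ℝ 2 f U) (e : E) : ContDiffOn ℝ 1 (fun x => fderiv ℝ f x e) U :=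
  (hf.fderiv_of_isOpen hU (by norm_num)).clm_apply contDiffOn_const

theorem ContDiff.contDiff_fderiv_apply_const {f : E → ℝ} (hf : ContDiff ℝ 2 f) (e : E) :
    ContDiff ℝ 1 (fun x => fderiv ℝ f x e) :=
  (hf.fderiv_right (by norm_num)).clm_apply contDiff_const

theorem ContDiffAt.laplacian_eq_sum [FiniteDimensional ℝ E] {f : E → ℝ} {x : E}
    (hf : ContDiffAt ℝ 2 f x) {ι : Type*} [Fintype ι] (b : OrthonormalBasis ι ℝ E) :
    (Δ f) x = ∑ i, fderiv ℝ (fun y => fderiv ℝ f y (b i)) x (b i) := by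
  rw [InnerProductSpace.laplacian_eq_iteratedFDeriv_orthonormalBasis f b]
  refine Finset.sum_congr rfl fun i _ => ?_
  have h : DifferentiableAt ℝ (fderiv ℝ f) x :=
    (hf.fderiv_right (m := 1) (by norm_num)).differentiableAt (by norm_num)
  rw [iteratedFDeriv_two_apply, fderiv_clm_apply h (differentiableAt_const _)]
  simp

theorem inner_gradient_gradient_eq_sum [FiniteDimensional ℝ E] (f g : E → ℝ) (x : E)
    {ι : Type*} [Fintype ι] (b : OrthonormalBasis ι ℝ E) :
    inner ℝ (∇ f x) (∇ g x) = ∑ i, fderiv ℝ f x (b i) * fderiv ℝ g x (b i) := by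
  rw [← b.sum_inner_mul_inner]
  simp [inner_gradient_left, inner_gradient_right]

theorem tsupport_gradient_subset [CompleteSpace E] (g : E → ℝ) : tsupport (∇ g) ⊆ tsupport g := by
  refine closure_minimal (fun x hx => ?_) (isClosed_tsupport g)
  refine tsupport_fderiv_subset ℝ (subset_tsupport _ ?_)
  intro h
  exact hx (by simp [gradient, h])

theorem tsupport_laplacian_subset [FiniteDimensional ℝ E] (g : E → ℝ) :
    tsupport (Δ g) ⊆ tsupport g := by
  refine closure_minimal (fun x hx => ?_) (isClosed_tsupport g)
  by_contra h
  refine hx ?_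
  have h0 : g =ᶠ[𝓝 x] (fun _ => 0) := notMem_tsupport_iff_eventuallyEq.1 h
  rw [(InnerProductSpace.laplacian_congr_nhds h0).eq_of_nhds]
  simp

theorem ContDiff.continuous_gradient [CompleteSpace E] {g : E → ℝ} (hg : ContDiff ℝ 1 g) :
    Continuous (∇ g) :=
  (InnerProductSpace.toDual ℝ E).symm.continuous.comp (hg.continuous_fderiv (by norm_num))

theorem ContDiff.continuous_laplacian [FiniteDimensional ℝ E] {g : E → ℝ} (hg : ContDiff ℝ 2 g) :
    Continuous (Δ g) := by
  have : Δ g = fun x => ∑ i, fderiv ℝ (fun y => fderiv ℝ g y (stdOrthonormalBasis ℝ E i)) x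
      (stdOrthonormalBasis ℝ E i) := funext fun x => hg.contDiffAt.laplacian_eq_sum _
  rw [this]
  refine continuous_finsetSum _ fun i _ => ?_
  exact ((hg.contDiff_fderiv_apply_const _).continuous_fderiv (by norm_num)).clm_apply continuous_const

variable [FiniteDimensional ℝ E] [MeasurableSpace E] [BorelSpace E]

theorem integral_mul_fderiv_apply_eq_neg {U : Set E} (hU : IsOpen U) {f g : E → ℝ}
    (hf : ContDiffOn ℝ 1 f U) (hg : ContDiff ℝ 1 g) (hgc : HasCompactSupport g)
    (hgU : tsupport g ⊆ U) (e : E) :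
    ∫ x, f x * fderiv ℝ g x e = -∫ x, fderiv ℝ f x e * g x := by
  refine integral_mul_fderiv_eq_neg_fderiv_mul_of_integrable ?_ ?_ ?_ ?_ ?_
  · exact (hf.continuousOn_fderiv_apply hU e).integrable_mul_of_tsupport_subset hU
      hg.continuous hgc hgU
  · exact hf.continuousOn.integrable_mul_of_tsupport_subset hU
      ((hg.continuous_fderiv (by norm_num)).clm_apply continuous_const) (hgc.fderiv_apply ℝ e)
      ((tsupport_fderiv_apply_subset' g e).trans hgU)
  · exact hf.continuousOn.integrable_mul_of_tsupport_subset hU hg.continuous hgc hgU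
  · exact fun x hx => (hf.differentiableOn (by norm_num)).differentiableAt (hU.mem_nhds (hgU hx))
  · exact fun x _ => hg.differentiable (by norm_num) x

theorem integral_inner_gradient_eq_sum {U : Set E} (hU : IsOpen U) {f g : E → ℝ}
    (hf : ContDiffOn ℝ 1 f U) (hg : ContDiff ℝ 1 g) (hgc : HasCompactSupport g)
    (hgU : tsupport g ⊆ U) {ι : Type*} [Fintype ι] (b : OrthonormalBasis ι ℝ E) :
    ∫ x, inner ℝ (∇ f x) (∇ g x) = ∑ i, ∫ x, fderiv ℝ f x (b i) * fderiv ℝ g x (b i) := by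
  simp_rw [inner_gradient_gradient_eq_sum f g _ b]
  refine integral_finsetSum _ fun i _ => ?_
  exact (hf.continuousOn_fderiv_apply hU _).integrable_mul_of_tsupport_subset hU
      ((hg.continuous_fderiv (by norm_num)).clm_apply continuous_const) (hgc.fderiv_apply ℝ _)
      ((tsupport_fderiv_apply_subset' g _).trans hgU)

/-- Green's first identity, with the Laplacian on the compactly supported factor. -/
theorem integral_mul_laplacian_eq_neg {U : Set E} (hU : IsOpen U) {f g : E → ℝ}
    (hf : ContDiffOn ℝ 1 f U) (hg : ContDiff ℝ 2 g) (hgc : HasCompactSupport g)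
    (hgU : tsupport g ⊆ U) :
    ∫ x, f x * (Δ g) x = -∫ x, inner ℝ (∇ f x) (∇ g x) := by
  let b := stdOrthonormalBasis ℝ E
  rw [integral_inner_gradient_eq_sum hU hf (hg.of_le (by norm_num)) hgc hgU b,
    ← Finset.sum_neg_distrib]
  simp_rw [hg.contDiffAt.laplacian_eq_sum b, Finset.mul_sum]
  rw [integral_finsetSum]
  · refine Finset.sum_congr rfl fun i _ => ?_
    exact integral_mul_fderiv_apply_eq_neg hU hf (hg.contDiff_fderiv_apply_const _)
      (hgc.fderiv_apply ℝ _) ((tsupport_fderiv_apply_subset' g _).trans hgU) _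
  · intro i _
    exact hf.continuousOn.integrable_mul_of_tsupport_subset hU
      (((hg.contDiff_fderiv_apply_const _).continuous_fderiv (by norm_num)).clm_apply continuous_const)
      ((hgc.fderiv_apply ℝ _).fderiv_apply ℝ _)
      (((tsupport_fderiv_apply_subset' _ _).trans (tsupport_fderiv_apply_subset' g _)).trans hgU)

/-- Green's first identity, with the Laplacian on the factor which need not have
compact support. -/
theorem integral_laplacian_mul_eq_neg {U : Set E} (hU : IsOpen U) {f g : E → ℝ}
    (hf : ContDiffOn ℝ 2 f U) (hg : ContDiff ℝ 1 g) (hgc : HasCompactSupport g)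
    (hgU : tsupport g ⊆ U) :
    ∫ x, (Δ f) x * g x = -∫ x, inner ℝ (∇ f x) (∇ g x) := by
  let b := stdOrthonormalBasis ℝ E
  rw [integral_inner_gradient_eq_sum hU (hf.of_le (by norm_num)) hg hgc hgU b,
    ← Finset.sum_neg_distrib]
  have h (x : E) : (Δ f) x * g x
      = ∑ i, fderiv ℝ (fun y => fderiv ℝ f y (b i)) x (b i) * g x := by
    by_cases hx : g x = 0
    · simp [hx]
    · rw [(hf.contDiffAt (hU.mem_nhds (hgU (subset_tsupport g hx)))).laplacian_eq_sum b,
        Finset.sum_mul]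
  simp_rw [h]
  rw [integral_finsetSum]
  · refine Finset.sum_congr rfl fun i _ => ?_
    rw [integral_mul_fderiv_apply_eq_neg hU (hf.contDiffOn_fderiv_apply hU _) hg hgc hgU, neg_neg]
  · intro i _
    exact ((hf.contDiffOn_fderiv_apply hU _).continuousOn_fderiv_apply hU
      _).integrable_mul_of_tsupport_subset hU hg.continuous hgc hgU

/-- The two Green identities share the same Dirichlet integral, so the Laplacian moves from `g` onto
`f`, where it vanishes. -/
theorem integral_mul_laplacian_eq_zero_of_harmonicOnNhd {U : Set E} (hU : IsOpen U) {f g : E → ℝ}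
    (hf : InnerProductSpace.HarmonicOnNhd f U) (hg : ContDiff ℝ 2 g) (hgc : HasCompactSupport g)
    (hgU : tsupport g ⊆ U) : ∫ x, f x * (Δ g) x = 0 := by
  rw [integral_mul_laplacian_eq_neg hU (hf.contDiffOn.of_le (by norm_num)) hg hgc hgU,
    ← integral_laplacian_mul_eq_neg hU hf.contDiffOn (hg.of_le (by norm_num)) hgc hgU]
  refine integral_eq_zero_of_ae (ae_of_all _ fun x => ?_)
  by_cases hx : g x = 0
  · simp [hx]
  · simp [(hf x (hgU (subset_tsupport g hx))).2.eq_of_nhds]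

/-- Poincaré's inequality in the direction `e`. -/
theorem integral_sq_le_mul_integral_fderiv_sq {g : E → ℝ} (hg : ContDiff ℝ 1 g)
    (hgc : HasCompactSupport g) {R : ℝ} (hgR : ∀ x ∈ tsupport g, ‖x‖ ≤ R) {e : E}
    (he : ‖e‖ = 1) :
    ∫ x, g x ^ 2 ≤ (2 * R) ^ 2 * ∫ x, fderiv ℝ g x e ^ 2 := by
  have hg1 : Continuous fun x => fderiv ℝ g x e :=
    (hg.continuous_fderiv (by norm_num)).clm_apply continuous_const
  -- `l` is the coordinate along `e`. Its derivative along `e` is `1`, so the integral of `g²` can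
  -- be integrated by parts against it.
  obtain ⟨l, hle1, hlb⟩ : ∃ l : E →L[ℝ] ℝ, l e = 1 ∧ ∀ x, |l x| ≤ ‖x‖ :=
    ⟨innerSL ℝ e, by simp [he], fun x => by simpa [he] using (innerSL ℝ e).le_opNorm x⟩
  have hl' (x : E) : fderiv ℝ l x e = 1 := by rw [ContinuousLinearMap.fderiv, hle1]
  have hsq (x : E) : fderiv ℝ (fun x => g x ^ 2) x e = 2 * g x * fderiv ℝ g x e := by
    rw [fderiv_fun_pow _ (hg.differentiable (by norm_num) x)]
    simp
  have c1 : HasCompactSupport fun x => g x ^ 2 := by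
    simp_rw [sq]
    exact hgc.mul_left
  have c2 : HasCompactSupport fun x => fderiv ℝ g x e ^ 2 := by
    simp_rw [sq]
    exact (hgc.fderiv_apply ℝ e).mul_left
  have c3 : HasCompactSupport fun x => -(l x * (2 * g x * fderiv ℝ g x e)) := by
    refine HasCompactSupport.neg (HasCompactSupport.mul_left ?_)
    exact (hgc.fderiv_apply ℝ e).mul_left
  have key := integral_mul_fderiv_apply_eq_neg isOpen_univ l.contDiff.contDiffOn
    (hg.pow 2) c1 (Set.subset_univ _) e
  simp_rw [hl', one_mul, hsq] at key
  have i1 : Integrable fun x => g x ^ 2 :=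
    (hg.continuous.pow 2).integrable_of_hasCompactSupport c1
  have i2 : Integrable fun x => fderiv ℝ g x e ^ 2 :=
    (hg1.pow 2).integrable_of_hasCompactSupport c2
  have i3 : Integrable fun x => -(l x * (2 * g x * fderiv ℝ g x e)) :=
    (l.continuous.mul ((continuous_const.mul hg.continuous).mul
      hg1)).neg.integrable_of_hasCompactSupport c3
  -- Young's inequality with weight `1/2` on `g²`, which is then absorbed on the left; doubling
  -- `2R²` gives `(2R)²`.
  have hle : ∫ x, -(l x * (2 * g x * fderiv ℝ g x e))
      ≤ ∫ x, (1 / 2 * g x ^ 2 + 2 * R ^ 2 * fderiv ℝ g x e ^ 2) := by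
    refine integral_mono i3 ((i1.const_mul _).add (i2.const_mul _)) fun x => ?_
    by_cases hx : g x = 0
    · simp only [hx]
      ring_nf
      positivity
    have h1 : |l x| ≤ R := (hlb x).trans (hgR x (subset_tsupport g hx))
    have h2 : l x ^ 2 ≤ R ^ 2 := sq_le_sq' (abs_le.1 h1).1 (abs_le.1 h1).2
    have h3 := mul_le_mul_of_nonneg_right h2 (sq_nonneg (fderiv ℝ g x e))
    have h4 := sq_nonneg (g x + 2 * (l x * fderiv ℝ g x e))
    beta_reduce
    linarith
  rw [integral_neg, integral_add (i1.const_mul _) (i2.const_mul _), integral_const_mul,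
    integral_const_mul] at hle
  linarith

end IntegrationByParts

/-! ### Weak compactness in Hilbert spaces and limits of `L²` pairings. -/

section Hilbert

/-- Banach–Alaoglu along an ultrafilter, which needs no separability to extract a subsequence. The
limit stays in `S` because a closed subspace is its own double orthogonal, hence weakly closed. -/
theorem exists_mem_tendsto_inner_of_norm_le {H : Type*} [NormedAddCommGroup H]
    [InnerProductSpace ℝ H] [CompleteSpace H] {S : Submodule ℝ H} (hS : IsClosed (S : Set H))
    {z : ℕ → H} (hz : ∀ n, z n ∈ S) {C : ℝ} (hC : ∀ n, ‖z n‖ ≤ C) :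
    ∃ z₀ ∈ S, ∃ l : Ultrafilter ℕ, (l : Filter ℕ) ≤ atTop ∧
      ∀ a, Tendsto (fun n => inner ℝ (z n) a) l (𝓝 (inner ℝ z₀ a)) := by
  let l : Ultrafilter ℕ := Ultrafilter.of atTop
  have hl : (l : Filter ℕ) ≤ atTop := Ultrafilter.of_le _
  let f : ℕ → WeakDual ℝ H := fun n => StrongDual.toWeakDual (InnerProductSpace.toDual ℝ H (z n))
  obtain ⟨y, -, hy⟩ := (WeakDual.isCompact_closedBall (𝕜 := ℝ) (E := H) 0 C).ultrafilter_le_nhds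
    (l.map f) (by
      refine le_principal_iff.2 (Filter.mem_map.2 (univ_mem' fun n => ?_))
      simpa [f] using hC n)
  let z₀ : H := (InnerProductSpace.toDual ℝ H).symm (WeakDual.toStrongDual y)
  have key (a : H) : Tendsto (fun n => inner ℝ (z n) a) l (𝓝 (inner ℝ z₀ a)) := by
    have h : Tendsto (fun n => f n a) l (𝓝 (y a)) :=
      ((WeakDual.eval_continuous a).tendsto y).comp hy
    simpa [f, z₀] using h
  refine ⟨z₀, ?_, l, hl, key⟩
  rw [← hS.submodule_topologicalClosure_eq, ← Submodule.orthogonal_orthogonal_eq_closure]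
  refine (Submodule.mem_orthogonal' _ _).2 fun a ha => ?_
  refine tendsto_nhds_unique (key a) ?_
  simp_rw [fun n => (Submodule.mem_orthogonal _ _).1 ha (z n) (hz n)]
  exact tendsto_const_nhds

theorem tendsto_integral_inner_of_tendsto_eLpNorm {α F : Type*} [MeasurableSpace α] {μ : Measure α}
    [NormedAddCommGroup F] [InnerProductSpace ℝ F] {f : ℕ → α → F} {f₀ g : α → F}
    (hf : ∀ n, MemLp (f n) 2 μ) (hf₀ : MemLp f₀ 2 μ) (hg : MemLp g 2 μ)
    (h : Tendsto (fun n => eLpNorm (fun x => f₀ x - f n x) 2 μ) atTop (𝓝 0)) :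
    Tendsto (fun n => ∫ x, inner ℝ (f n x) (g x) ∂μ) atTop (𝓝 (∫ x, inner ℝ (f₀ x) (g x) ∂μ)) := by
  have key {u : α → F} (hu : MemLp u 2 μ) :
      inner ℝ (hu.toLp u) (hg.toLp g) = ∫ x, inner ℝ (u x) (g x) ∂μ := by
    rw [L2.inner_def]
    refine integral_congr_ae ?_
    filter_upwards [hu.coeFn_toLp, hg.coeFn_toLp] with x h1 h2
    rw [h1, h2]
  simp_rw [← fun n => key (hf n), ← key hf₀]
  refine Tendsto.inner ?_ tendsto_const_nhds
  rw [Lp.tendsto_Lp_iff_tendsto_eLpNorm'']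
  simp_rw [eLpNorm_sub_comm (f _) f₀]
  exact h

end Hilbert

/-! ### Test functions in `L² × L²` and their closure `H¹₀`. -/

section H10

variable {d : ℕ} {Ω : TopologicalSpace.Opens (EuclideanSpace ℝ (Fin d))}

namespace TestFunction

theorem contDiff_nat (w : 𝓓(Ω, ℝ)) (n : ℕ) : ContDiff ℝ n w :=
  w.contDiff.of_le (by exact_mod_cast le_top)

theorem contDiff_one (w : 𝓓(Ω, ℝ)) : ContDiff ℝ 1 w := w.contDiff_nat 1

theorem contDiff_two (w : 𝓓(Ω, ℝ)) : ContDiff ℝ 2 w := w.contDiff_nat 2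

theorem hasCompactSupport_gradient (w : 𝓓(Ω, ℝ)) : HasCompactSupport (∇ w) :=
  w.hasCompactSupport.of_isClosed_subset (isClosed_tsupport _) (tsupport_gradient_subset _)

theorem hasCompactSupport_laplacian (w : 𝓓(Ω, ℝ)) : HasCompactSupport (Δ (w : _ → ℝ)) :=
  w.hasCompactSupport.of_isClosed_subset (isClosed_tsupport _) (tsupport_laplacian_subset _)

theorem memLp_restrict (w : 𝓓(Ω, ℝ)) : MemLp w 2 (volume.restrict Ω) :=
  (w.continuous.memLp_of_hasCompactSupport w.hasCompactSupport).restrict _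

theorem memLp_gradient (w : 𝓓(Ω, ℝ)) : MemLp (∇ w) 2 (volume.restrict Ω) :=
  (w.contDiff_one.continuous_gradient.memLp_of_hasCompactSupport
    w.hasCompactSupport_gradient).restrict _

theorem memLp_laplacian (w : 𝓓(Ω, ℝ)) : MemLp (Δ (w : _ → ℝ)) 2 (volume.restrict Ω) :=
  (w.contDiff_two.continuous_laplacian.memLp_of_hasCompactSupport
    w.hasCompactSupport_laplacian).restrict _

theorem gradient_add (w q : 𝓓(Ω, ℝ)) : ∇ (w + q : 𝓓(Ω, ℝ)) = ∇ w + ∇ q := by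
  ext1 x
  have h := fderiv_add (w.contDiff_one.differentiable (by norm_num) x)
    (q.contDiff_one.differentiable (by norm_num) x)
  simp only [gradient, Pi.add_apply, FunLike.coe_add, h, map_add]

theorem gradient_sub (w q : 𝓓(Ω, ℝ)) : ∇ (w - q : 𝓓(Ω, ℝ)) = ∇ w - ∇ q := by
  ext1 x
  have h := fderiv_sub (w.contDiff_one.differentiable (by norm_num) x)
    (q.contDiff_one.differentiable (by norm_num) x)
  simp only [gradient, Pi.sub_apply, FunLike.coe_sub, h, map_sub]

theorem gradient_smul (c : ℝ) (w : 𝓓(Ω, ℝ)) : ∇ (c • w : 𝓓(Ω, ℝ)) = c • ∇ w := by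
  ext1 x
  have h := fderiv_const_smul (w.contDiff_one.differentiable (by norm_num) x) c
  simp [gradient, h]

/-- The embedding of the test functions in `L² × L²`, by a function and its gradient. -/
noncomputable def toH1 : 𝓓(Ω, ℝ) →ₗ[ℝ] WithLp 2 (Lp ℝ 2
      (volume.restrict (Ω : Set (EuclideanSpace ℝ (Fin d)))) ×
    Lp (EuclideanSpace ℝ (Fin d)) 2 (volume.restrict (Ω : Set (EuclideanSpace ℝ (Fin d))))) where
  toFun w := WithLp.toLp 2 (w.memLp_restrict.toLp w, w.memLp_gradient.toLp (∇ w))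
  map_add' w q := by
    rw [← WithLp.toLp_add, Prod.mk_add_mk, ← MemLp.toLp_add, ← MemLp.toLp_add]
    simp_rw [gradient_add, FunLike.coe_add]
  map_smul' c w := by
    rw [RingHom.id_apply, ← WithLp.toLp_smul, Prod.smul_mk, ← MemLp.toLp_const_smul,
      ← MemLp.toLp_const_smul]
    simp_rw [gradient_smul, FunLike.coe_smul]

theorem norm_toH1_sq (w : 𝓓(Ω, ℝ)) :
    ‖toH1 w‖ ^ 2 = (∫ x in (Ω : Set (EuclideanSpace ℝ (Fin d))), w x ^ 2)
      + ∫ x in (Ω : Set (EuclideanSpace ℝ (Fin d))), ‖∇ w x‖ ^ 2 := by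
  rw [WithLp.prod_norm_sq_eq_of_L2]
  congr 1
  · rw [← real_inner_self_eq_norm_sq, L2.inner_def]
    refine integral_congr_ae ?_
    filter_upwards [w.memLp_restrict.coeFn_toLp] with x h1
    simp [toH1, sq, h1]
  · rw [← real_inner_self_eq_norm_sq, L2.inner_def]
    refine integral_congr_ae ?_
    filter_upwards [w.memLp_gradient.coeFn_toLp] with x h1
    rw [real_inner_self_eq_norm_sq]
    simp [toH1, h1]

theorem setIntegral_mul_laplacian (w q : 𝓓(Ω, ℝ)) :
    ∫ x in (Ω : Set (EuclideanSpace ℝ (Fin d))), w x * (Δ (q : _ → ℝ)) x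
      = -∫ x in (Ω : Set (EuclideanSpace ℝ (Fin d))), inner ℝ (∇ w x) (∇ q x) := by
  rw [setIntegral_eq_integral_of_forall_compl_eq_zero,
    setIntegral_eq_integral_of_forall_compl_eq_zero]
  · exact integral_mul_laplacian_eq_neg isOpen_univ w.contDiff_one.contDiffOn q.contDiff_two
      q.hasCompactSupport (Set.subset_univ _)
  · intro x hx
    rw [image_eq_zero_of_notMem_tsupport (f := ∇ q)
      fun h => hx (q.tsupport_subset (tsupport_gradient_subset _ h)), inner_zero_right]
  · intro x hx
    rw [image_eq_zero_of_notMem_tsupport (f := Δ (q : _ → ℝ))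
      fun h => hx (q.tsupport_subset (tsupport_laplacian_subset _ h)), mul_zero]

theorem gradient_apply (w : 𝓓(Ω, ℝ)) (x : EuclideanSpace ℝ (Fin d)) (j : Fin d) :
    (∇ w x) j = fderiv ℝ w x (EuclideanSpace.single j 1) := by
  rw [← inner_gradient_left, EuclideanSpace.inner_single_right]
  simp

theorem setIntegral_mul_gradient (w q : 𝓓(Ω, ℝ)) (j : Fin d) :
    ∫ x in (Ω : Set (EuclideanSpace ℝ (Fin d))), w x * (∇ q x) j
      = -∫ x in (Ω : Set (EuclideanSpace ℝ (Fin d))), (∇ w x) j * q x := by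
  rw [setIntegral_eq_integral_of_forall_compl_eq_zero,
    setIntegral_eq_integral_of_forall_compl_eq_zero]
  · simp_rw [gradient_apply]
    exact integral_mul_fderiv_apply_eq_neg isOpen_univ w.contDiff_one.contDiffOn q.contDiff_one
      q.hasCompactSupport (Set.subset_univ _) _
  · intro x hx
    rw [image_eq_zero_of_notMem_tsupport fun h => hx (q.tsupport_subset h), mul_zero]
  · intro x hx
    rw [image_eq_zero_of_notMem_tsupport (f := ∇ q)
      fun h => hx (q.tsupport_subset (tsupport_gradient_subset _ h))]
    simp

end TestFunction

theorem hasWeakGradient_of_tendsto {v : EuclideanSpace ℝ (Fin d) → ℝ}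
    {G : EuclideanSpace ℝ (Fin d) → EuclideanSpace ℝ (Fin d)} {w : ℕ → 𝓓(Ω, ℝ)}
    (hv : MemLp v 2 (volume.restrict Ω)) (hG : MemLp G 2 (volume.restrict Ω))
    (h1 : Tendsto (fun n => eLpNorm (fun x => v x - w n x) 2 (volume.restrict Ω)) atTop (𝓝 0))
    (h2 : Tendsto (fun n => eLpNorm (fun x => G x - ∇ (w n) x) 2 (volume.restrict Ω)) atTop (𝓝 0)) :
    HasWeakGradient Ω v G := by
  intro q j
  have hq : MemLp (fun x => (∇ q x) j) 2 (volume.restrict (Ω : Set (EuclideanSpace ℝ (Fin d)))) :=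
    (EuclideanSpace.proj (𝕜 := ℝ) j).comp_memLp' q.memLp_gradient
  -- Pairing with the vector field `q eⱼ` turns the `j`-th component of the gradient into an `L²`
  -- inner product.
  have hq' : MemLp (fun x => EuclideanSpace.single j (q x)) 2 (volume.restrict (Ω : Set (EuclideanSpace ℝ (Fin d)))) := by
    refine MemLp.of_le q.memLp_restrict ?_ (ae_of_all _ fun x => by simp)
    have h : Continuous fun t : ℝ => EuclideanSpace.single j t := by
      have : (fun t : ℝ => EuclideanSpace.single j t)
          = fun t : ℝ => t • EuclideanSpace.single j (1 : ℝ) := by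
        ext t i
        simp
      rw [this]
      fun_prop
    exact (h.comp q.continuous).aestronglyMeasurable
  have t1 := tendsto_integral_inner_of_tendsto_eLpNorm (fun n => (w n).memLp_restrict) hv hq h1
  have t2 := tendsto_integral_inner_of_tendsto_eLpNorm (fun n => (w n).memLp_gradient) hG hq' h2
  simp only [RCLike.inner_apply, conj_trivial, EuclideanSpace.inner_single_right] at t1 t2
  simp_rw [fun n x => mul_comm ((∇ q x) j) (w n x), fun x => mul_comm ((∇ q x) j) (v x)] at t1
  simp_rw [fun n x => mul_comm (q x) ((∇ (w n) x) j), fun x => mul_comm (q x) ((G x) j)] at t2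
  exact tendsto_nhds_unique t1 (t2.neg.congr fun n => ((w n).setIntegral_mul_gradient q j).symm)

theorem setIntegral_mul_laplacian_of_tendsto {v : EuclideanSpace ℝ (Fin d) → ℝ}
    {G : EuclideanSpace ℝ (Fin d) → EuclideanSpace ℝ (Fin d)} {w : ℕ → 𝓓(Ω, ℝ)}
    (hv : MemLp v 2 (volume.restrict Ω)) (hG : MemLp G 2 (volume.restrict Ω))
    (h1 : Tendsto (fun n => eLpNorm (fun x => v x - w n x) 2 (volume.restrict Ω)) atTop (𝓝 0))
    (h2 : Tendsto (fun n => eLpNorm (fun x => G x - ∇ (w n) x) 2 (volume.restrict Ω)) atTop (𝓝 0))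
    (q : 𝓓(Ω, ℝ)) :
    ∫ x in (Ω : Set (EuclideanSpace ℝ (Fin d))), v x * (Δ (q : _ → ℝ)) x
      = -∫ x in (Ω : Set (EuclideanSpace ℝ (Fin d))), inner ℝ (G x) (∇ q x) := by
  have t1 := tendsto_integral_inner_of_tendsto_eLpNorm (fun n => (w n).memLp_restrict) hv
    q.memLp_laplacian h1
  have t2 := tendsto_integral_inner_of_tendsto_eLpNorm (fun n => (w n).memLp_gradient) hG
    q.memLp_gradient h2
  simp only [RCLike.inner_apply, conj_trivial] at t1
  simp_rw [fun n x => mul_comm ((Δ (q : _ → ℝ)) x) (w n x),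
    fun x => mul_comm ((Δ (q : _ → ℝ)) x) (v x)] at t1
  exact tendsto_nhds_unique t1 (t2.neg.congr fun n => ((w n).setIntegral_mul_laplacian q).symm)

/-- An `L²` limit of test functions with bounded gradients belongs to `H¹₀`. -/
theorem exists_isH10_of_tendsto_of_bounded {v : EuclideanSpace ℝ (Fin d) → ℝ} {w : ℕ → 𝓓(Ω, ℝ)}
    (hv : MemLp v 2 (volume.restrict Ω))
    (h1 : Tendsto (fun n => eLpNorm (fun x => v x - w n x) 2 (volume.restrict Ω)) atTop (𝓝 0))
    {C : ℝ} (hC : ∀ n, testH1Norm Ω (w n) ≤ C) :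
    ∃ G, IsH10 Ω v G ∧ ∀ q : 𝓓(Ω, ℝ),
      ∫ x in (Ω : Set (EuclideanSpace ℝ (Fin d))), v x * (Δ (q : _ → ℝ)) x
        = -∫ x in (Ω : Set (EuclideanSpace ℝ (Fin d))), inner ℝ (G x) (∇ q x) := by
  let S := (LinearMap.range (TestFunction.toH1 (Ω := Ω))).topologicalClosure
  have hT (n : ℕ) : ‖TestFunction.toH1 (w n)‖ ≤ C := by
    refine le_trans (le_of_eq ?_) (hC n)
    rw [testH1Norm, ← TestFunction.norm_toH1_sq, Real.sqrt_sq (norm_nonneg _)]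
  obtain ⟨z, hzS, l, hl, hz⟩ := exists_mem_tendsto_inner_of_norm_le (S := S)
    (Submodule.isClosed_topologicalClosure _)
    (fun n => Submodule.le_topologicalClosure _ (LinearMap.mem_range_self _ (w n))) hT
  -- The first components converge strongly to `v`, so the weak limit has `v` as its first
  -- component.
  have hz1 : z.fst = hv.toLp v := by
    refine ext_inner_right ℝ fun f => ?_
    have t1 := hz (WithLp.toLp 2 (f, 0))
    simp only [WithLp.prod_inner_apply, inner_zero_right, add_zero] at t1
    refine tendsto_nhds_unique t1 ?_
    have t2 : Tendsto (fun n => (w n).memLp_restrict.toLp (w n)) atTop (𝓝 (hv.toLp v)) := by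
      rw [Lp.tendsto_Lp_iff_tendsto_eLpNorm'']
      simp_rw [eLpNorm_sub_comm _ v]
      exact h1
    exact (t2.inner tendsto_const_nhds).mono_left hl
  -- The gradients of `w n` converge only weakly. Since `z` lies in the norm closure, a new sequence
  -- `q` of test functions converges to it strongly.
  obtain ⟨y, hy, hyz⟩ := mem_closure_iff_seq_limit.1
    (show z ∈ closure (LinearMap.range (TestFunction.toH1 (Ω := Ω)) : Set _) from hzS)
  choose q hq using hy
  obtain rfl : (fun n => TestFunction.toH1 (q n)) = y := funext hq
  have hG : MemLp (z.snd : _ → EuclideanSpace ℝ (Fin d)) 2 (volume.restrict (Ω : Set (EuclideanSpace ℝ (Fin d)))) :=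
    Lp.memLp _
  have a1 : Tendsto (fun n => eLpNorm (fun x => v x - q n x) 2 (volume.restrict Ω)) atTop (𝓝 0) := by
    have t : Tendsto (fun n => (q n).memLp_restrict.toLp (q n)) atTop (𝓝 (hv.toLp v)) := by
      rw [← hz1]
      exact ((WithLp.continuous_fst 2 _ _).tendsto z).comp hyz
    rw [Lp.tendsto_Lp_iff_tendsto_eLpNorm''] at t
    simp_rw [eLpNorm_sub_comm _ v] at t
    exact t
  have a2 : Tendsto (fun n => eLpNorm (fun x => z.snd x - ∇ (q n) x) 2 (volume.restrict Ω))
      atTop (𝓝 0) := by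
    have t : Tendsto (fun n => (q n).memLp_gradient.toLp (∇ (q n))) atTop (𝓝 (hG.toLp z.snd)) := by
      rw [Lp.toLp_coeFn]
      exact ((WithLp.continuous_snd 2 _ _).tendsto z).comp hyz
    rw [Lp.tendsto_Lp_iff_tendsto_eLpNorm''] at t
    simp_rw [eLpNorm_sub_comm _ (z.snd : _ → EuclideanSpace ℝ (Fin d))] at t
    exact t
  exact ⟨z.snd, ⟨⟨hv, hG, hasWeakGradient_of_tendsto hv hG a1 a2⟩, q, a1, a2⟩,
    setIntegral_mul_laplacian_of_tendsto hv hG a1 a2⟩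

end H10

/-! ### Poincaré's inequality on `H¹₀` and uniqueness for the weak problem. -/

section Uniqueness

variable {d : ℕ} {Ω : TopologicalSpace.Opens (EuclideanSpace ℝ (Fin d))}

theorem MeasureTheory.MemLp.norm_toLp_sq_eq_integral {α F : Type*} [MeasurableSpace α]
    {μ : Measure α} [NormedAddCommGroup F] [InnerProductSpace ℝ F] {f : α → F} (hf : MemLp f 2 μ) :
    ‖hf.toLp f‖ ^ 2 = ∫ x, ‖f x‖ ^ 2 ∂μ := by
  rw [← real_inner_self_eq_norm_sq, L2.inner_def]
  refine integral_congr_ae ?_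
  filter_upwards [hf.coeFn_toLp] with x h
  rw [h, real_inner_self_eq_norm_sq]

theorem MeasureTheory.MemLp.integrable_real_inner {α F : Type*} [MeasurableSpace α]
    {μ : Measure α} [NormedAddCommGroup F] [InnerProductSpace ℝ F] {f g : α → F}
    (hf : MemLp f 2 μ) (hg : MemLp g 2 μ) : Integrable (fun x => inner ℝ (f x) (g x)) μ := by
  refine (L2.integrable_inner (𝕜 := ℝ) (hf.toLp f) (hg.toLp g)).congr ?_
  filter_upwards [hf.coeFn_toLp, hg.coeFn_toLp] with x h1 h2
  rw [h1, h2]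

theorem tendsto_integral_norm_sq_of_tendsto_eLpNorm {α F : Type*} [MeasurableSpace α]
    {μ : Measure α} [NormedAddCommGroup F] [InnerProductSpace ℝ F] {f : ℕ → α → F} {f₀ : α → F}
    (hf : ∀ n, MemLp (f n) 2 μ) (hf₀ : MemLp f₀ 2 μ)
    (h : Tendsto (fun n => eLpNorm (fun x => f₀ x - f n x) 2 μ) atTop (𝓝 0)) :
    Tendsto (fun n => ∫ x, ‖f n x‖ ^ 2 ∂μ) atTop (𝓝 (∫ x, ‖f₀ x‖ ^ 2 ∂μ)) := by
  simp_rw [← fun n => (hf n).norm_toLp_sq_eq_integral, ← hf₀.norm_toLp_sq_eq_integral]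
  refine Tendsto.pow (Tendsto.norm ?_) 2
  rw [Lp.tendsto_Lp_iff_tendsto_eLpNorm'']
  simp_rw [eLpNorm_sub_comm (f _) f₀]
  exact h

theorem TestFunction.setIntegral_sq_le (hd : 0 < d) {R : ℝ} (hR : ∀ x ∈ Ω, ‖x‖ ≤ R) (w : 𝓓(Ω, ℝ)) :
    ∫ x in (Ω : Set (EuclideanSpace ℝ (Fin d))), ‖w x‖ ^ 2
      ≤ (2 * R) ^ 2 * ∫ x in (Ω : Set (EuclideanSpace ℝ (Fin d))), ‖∇ w x‖ ^ 2 := by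
  rw [setIntegral_eq_integral_of_forall_compl_eq_zero,
    setIntegral_eq_integral_of_forall_compl_eq_zero]
  · simp_rw [Real.norm_eq_abs, sq_abs]
    refine (integral_sq_le_mul_integral_fderiv_sq w.contDiff_one w.hasCompactSupport
      (fun x hx => hR x (w.tsupport_subset hx))
      (e := EuclideanSpace.single (⟨0, hd⟩ : Fin d) (1 : ℝ)) (by simp)).trans ?_
    refine mul_le_mul_of_nonneg_left ?_ (sq_nonneg _)
    refine integral_mono_of_nonneg (ae_of_all _ fun x => sq_nonneg _) ?_ (ae_of_all _ fun x => ?_)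
    · exact (w.contDiff_one.continuous_gradient.memLp_of_hasCompactSupport
        (p := (2 : ℕ)) w.hasCompactSupport_gradient).integrable_norm_pow (by norm_num)
    · beta_reduce
      rw [← inner_gradient_left, sq_le_sq, abs_norm]
      exact (abs_real_inner_le_norm _ _).trans (by simp)
  · intro x hx
    rw [image_eq_zero_of_notMem_tsupport (f := ∇ w)
      fun h => hx (w.tsupport_subset (tsupport_gradient_subset _ h))]
    simp
  · intro x hx
    rw [image_eq_zero_of_notMem_tsupport fun h => hx (w.tsupport_subset h)]
    simp

variable {v v' : EuclideanSpace ℝ (Fin d) → ℝ}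
  {G G' : EuclideanSpace ℝ (Fin d) → EuclideanSpace ℝ (Fin d)}

theorem IsH10.setIntegral_sq_le (hd : 0 < d) {R : ℝ} (hR : ∀ x ∈ Ω, ‖x‖ ≤ R) (h : IsH10 Ω v G) :
    ∫ x in (Ω : Set (EuclideanSpace ℝ (Fin d))), ‖v x‖ ^ 2
      ≤ (2 * R) ^ 2 * ∫ x in (Ω : Set (EuclideanSpace ℝ (Fin d))), ‖G x‖ ^ 2 := by
  obtain ⟨w, h1, h2⟩ := h.exists_approx
  exact le_of_tendsto_of_tendsto'
    (tendsto_integral_norm_sq_of_tendsto_eLpNorm (fun n => (w n).memLp_restrict) h.memLp h1)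
    ((tendsto_integral_norm_sq_of_tendsto_eLpNorm (fun n => (w n).memLp_gradient)
      h.memLp_grad h2).const_mul _) fun n => (w n).setIntegral_sq_le hd hR

theorem IsH10.sub (h : IsH10 Ω v G) (h' : IsH10 Ω v' G') :
    IsH10 Ω (fun x => v x - v' x) (fun x => G x - G' x) := by
  obtain ⟨w, h1, h2⟩ := h.exists_approx
  obtain ⟨w', h1', h2'⟩ := h'.exists_approx
  have key {F : Type} [NormedAddCommGroup F] {μ : Measure (EuclideanSpace ℝ (Fin d))}
      {f f' : EuclideanSpace ℝ (Fin d) → F} {g g' : ℕ → EuclideanSpace ℝ (Fin d) → F}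
      (hf : MemLp f 2 μ) (hf' : MemLp f' 2 μ) (hg : ∀ n, MemLp (g n) 2 μ)
      (hg' : ∀ n, MemLp (g' n) 2 μ)
      (t : Tendsto (fun n => eLpNorm (fun x => f x - g n x) 2 μ) atTop (𝓝 0))
      (t' : Tendsto (fun n => eLpNorm (fun x => f' x - g' n x) 2 μ) atTop (𝓝 0)) :
      Tendsto (fun n => eLpNorm (fun x => (f x - f' x) - (g n x - g' n x)) 2 μ) atTop (𝓝 0) := by
    refine tendsto_of_tendsto_of_tendsto_of_le_of_le tendsto_const_nhds
      (by simpa using t.add t') (fun _ => zero_le) fun n => ?_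
    refine le_trans (le_of_eq ?_) (eLpNorm_sub_le (hf.sub (hg n)).1 (hf'.sub (hg' n)).1 (by norm_num))
    congr 1
    ext x
    simp only [Pi.sub_apply]
    abel
  have a1 := key h.memLp h'.memLp (fun n => (w n).memLp_restrict) (fun n => (w' n).memLp_restrict)
    h1 h1'
  have a2 := key h.memLp_grad h'.memLp_grad (fun n => (w n).memLp_gradient)
    (fun n => (w' n).memLp_gradient) h2 h2'
  have e2 : Tendsto (fun n => eLpNorm (fun x => (G x - G' x) - ∇ (w n - w' n : 𝓓(Ω, ℝ)) x) 2
      (volume.restrict Ω)) atTop (𝓝 0) := by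
    simp_rw [TestFunction.gradient_sub]
    exact a2
  exact ⟨⟨h.memLp.sub h'.memLp, h.memLp_grad.sub h'.memLp_grad, hasWeakGradient_of_tendsto
    (w := fun n => w n - w' n) (h.memLp.sub h'.memLp) (h.memLp_grad.sub h'.memLp_grad) a1 e2⟩,
    fun n => w n - w' n, a1, e2⟩

/-- `G` is itself a limit of gradients of test functions, so orthogonality to all of these makes it
orthogonal to itself. -/
theorem IsH10.integral_norm_grad_sq_eq_zero (h : IsH10 Ω v G)
    (hG : ∀ q : 𝓓(Ω, ℝ), ∫ x in (Ω : Set (EuclideanSpace ℝ (Fin d))), inner ℝ (G x) (∇ q x) = 0) :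
    ∫ x in (Ω : Set (EuclideanSpace ℝ (Fin d))), ‖G x‖ ^ 2 = 0 := by
  obtain ⟨w, h1, h2⟩ := h.exists_approx
  have t := tendsto_integral_inner_of_tendsto_eLpNorm (fun n => (w n).memLp_gradient) h.memLp_grad
    h.memLp_grad h2
  simp_rw [fun n x => real_inner_comm (G x) (∇ (w n) x), hG, real_inner_self_eq_norm_sq] at t
  exact (tendsto_nhds_unique t tendsto_const_nhds)

/-- The weak Dirichlet problem for the Poisson equation has at most one solution in `H¹₀`. -/
theorem IsH10.ae_eq_of_forall_integral_inner_eq (hd : 0 < d)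
    (hbdd : Bornology.IsBounded (Ω : Set (EuclideanSpace ℝ (Fin d))))
    (h : IsH10 Ω v G) (h' : IsH10 Ω v' G')
    (hG : ∀ q : 𝓓(Ω, ℝ), ∫ x in (Ω : Set (EuclideanSpace ℝ (Fin d))), inner ℝ (G x) (∇ q x)
      = ∫ x in (Ω : Set (EuclideanSpace ℝ (Fin d))), inner ℝ (G' x) (∇ q x)) :
    v =ᵐ[volume.restrict (Ω : Set (EuclideanSpace ℝ (Fin d)))] v' := by
  obtain ⟨R, hR⟩ := hbdd.exists_norm_le
  have hs := h.sub h'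
  have h0 := hs.integral_norm_grad_sq_eq_zero fun q => by
    simp_rw [inner_sub_left]
    rw [integral_sub, hG q, sub_self]
    · exact MemLp.integrable_real_inner h.memLp_grad q.memLp_gradient
    · exact MemLp.integrable_real_inner h'.memLp_grad q.memLp_gradient
  have h1 := hs.setIntegral_sq_le hd hR
  rw [h0, mul_zero] at h1
  have h2 := le_antisymm h1 (integral_nonneg fun x => sq_nonneg _)
  rw [integral_eq_zero_iff_of_nonneg (fun x => sq_nonneg _)
    (by simpa using hs.memLp.integrable_norm_pow (by norm_num))] at h2
  filter_upwards [h2] with x hx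
  simpa [sub_eq_zero] using hx

end Uniqueness

/-! ### A smooth soft threshold. -/

section Truncation

/-- A smooth soft threshold: a nondecreasing `1`-Lipschitz function, uniformly close to the
identity, which vanishes near `0`. -/
theorem exists_contDiff_truncation {ε : ℝ} (hε : 0 < ε) :
    ∃ F : ℝ → ℝ, ContDiff ℝ (⊤ : ℕ∞) F ∧ (∀ t, |t| ≤ ε → F t = 0) ∧
      (∀ t, 0 ≤ deriv F t ∧ deriv F t ≤ 1) ∧ ∀ t, |F t - t| ≤ 4 * ε := by
  -- `F` is the primitive of `1 - b`: flat where `b = 1`, and off from the identity by at most the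
  -- integral of `b`, hence by the length `4ε` of `[-2ε, 2ε]`.
  let b : ContDiffBump (0 : ℝ) := ⟨ε, 2 * ε, hε, by linarith⟩
  have hb : Continuous b := b.continuous
  let F : ℝ → ℝ := fun t => ∫ s in (0 : ℝ)..t, (1 - b s)
  have hc : Continuous fun s => 1 - b s := continuous_const.sub hb
  have hF : deriv F = fun s => 1 - b s := funext fun t => hc.deriv_integral _ 0 t
  refine ⟨F, ?_, ?_, ?_, ?_⟩
  · rw [contDiff_infty_iff_deriv]
    refine ⟨fun t => (hc.integral_hasStrictDerivAt 0 t).hasDerivAt.differentiableAt, ?_⟩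
    rw [hF]
    exact contDiff_const.sub b.contDiff
  · intro t ht
    refine (intervalIntegral.integral_congr (g := fun _ => (0 : ℝ)) fun s hs => ?_).trans (by simp)
    have : s ∈ Metric.closedBall (0 : ℝ) b.rIn := by
      rw [mem_closedBall_zero_iff, Real.norm_eq_abs]
      have h1 : |s - 0| ≤ |t - 0| := Set.abs_sub_left_of_mem_uIcc hs
      simp only [sub_zero] at h1
      exact h1.trans ht
    simp [b.one_of_mem_closedBall this]
  · intro t
    rw [hF]
    exact ⟨sub_nonneg.2 b.le_one, by linarith [b.nonneg (x := t)]⟩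
  · intro t
    have h1 : F t - t = -∫ s in (0 : ℝ)..t, b s := by
      simp only [F]
      rw [intervalIntegral.integral_sub (by simp) (hb.intervalIntegrable _ _)]
      simp
    rw [h1, abs_neg]
    rw [← Real.norm_eq_abs]
    calc ‖∫ s in (0 : ℝ)..t, b s‖ ≤ ∫ s in Set.uIoc 0 t, ‖b s‖ :=
          intervalIntegral.norm_integral_le_integral_norm_uIoc
      _ ≤ ∫ s, ‖b s‖ :=
          setIntegral_le_integral b.integrable.norm (ae_of_all _ fun s => norm_nonneg _)
      _ = ∫ s, b s := by
          simp_rw [Real.norm_of_nonneg (b.nonneg)]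
      _ ≤ volume.real (Metric.closedBall (0 : ℝ) b.rOut) := b.integral_le_measure_closedBall volume
      _ = 4 * ε := by
          rw [Real.volume_real_closedBall b.rOut_pos.le]
          simp only [b]
          ring

end Truncation

/-! ### Approximation by thresholded mollifications. -/

section Mollification

theorem laplacian_comp_add_right {E : Type*} [NormedAddCommGroup E] [InnerProductSpace ℝ E]
    [FiniteDimensional ℝ E] (g : E → ℝ) (y x : E) :
    (Δ fun z => g (z + y)) x = (Δ g) (x + y) := by
  simp only [InnerProductSpace.laplacian_eq_iteratedFDeriv_stdOrthonormalBasis,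
    iteratedFDeriv_comp_add_right]

theorem gradient_comp_add_right {E : Type*} [NormedAddCommGroup E] [InnerProductSpace ℝ E]
    [CompleteSpace E] (g : E → ℝ) (y x : E) :
    ∇ (fun z => g (z + y)) x = ∇ g (x + y) := by
  simp only [gradient, fderiv_comp_add_right]

variable {d : ℕ} {Ω : TopologicalSpace.Opens (EuclideanSpace ℝ (Fin d))}

theorem setIntegral_eq_integral_of_tsupport_subset {X F : Type*} [TopologicalSpace X]
    [MeasurableSpace X] {μ : Measure X} [NormedAddCommGroup F] [NormedSpace ℝ F] {U : Set X}
    {f : X → F} (hf : tsupport f ⊆ U) : ∫ x in U, f x ∂μ = ∫ x, f x ∂μ :=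
  setIntegral_eq_integral_of_forall_compl_eq_zero fun _ hx =>
    image_eq_zero_of_notMem_tsupport fun h => hx (hf h)

theorem testH1Norm_eq (w : 𝓓(Ω, ℝ)) :
    testH1Norm Ω w = √((∫ x, w x ^ 2) + ∫ x, ‖∇ w x‖ ^ 2) := by
  rw [testH1Norm, setIntegral_eq_integral_of_forall_compl_eq_zero,
    setIntegral_eq_integral_of_forall_compl_eq_zero]
  · intro x hx
    rw [image_eq_zero_of_notMem_tsupport (f := ∇ w)
      fun h => hx (w.tsupport_subset (tsupport_gradient_subset _ h))]
    simp
  · intro x hx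
    rw [image_eq_zero_of_notMem_tsupport fun h => hx (w.tsupport_subset h)]
    simp

theorem setIntegral_mul_laplacian_eq_integral (v : EuclideanSpace ℝ (Fin d) → ℝ) (w : 𝓓(Ω, ℝ)) :
    ∫ x in (Ω : Set (EuclideanSpace ℝ (Fin d))), v x * (Δ (w : _ → ℝ)) x
      = ∫ x, v x * (Δ (w : _ → ℝ)) x :=
  setIntegral_eq_integral_of_tsupport_subset
    (tsupport_mul_subset_right.trans ((tsupport_laplacian_subset _).trans w.tsupport_subset))

theorem tsupport_comp_add_right {E : Type*} [NormedAddCommGroup E] (g : E → ℝ) (y : E) :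
    tsupport (fun z => g (z + y)) = (fun z => z + y) ⁻¹' tsupport g :=
  tsupport_comp_eq_preimage g (Homeomorph.addRight y)

/-- The `δ`-margin around the support keeps the translate inside `Ω`, and Lebesgue measure is
translation invariant. -/
theorem exists_testFunction_comp_add_right (w : 𝓓(Ω, ℝ)) {δ : ℝ}
    (hδ : Metric.cthickening δ (tsupport w) ⊆ Ω) {y : EuclideanSpace ℝ (Fin d)} (hy : ‖y‖ ≤ δ) :
    ∃ q : 𝓓(Ω, ℝ), (∀ x, q x = w (x + y)) ∧ testH1Norm Ω q = testH1Norm Ω w := by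
  let q : 𝓓(Ω, ℝ) := ⟨fun x => w (x + y), w.contDiff.comp (contDiff_id.add contDiff_const),
    w.hasCompactSupport.comp_homeomorph (Homeomorph.addRight y), by
      rw [tsupport_comp_add_right]
      refine fun x hx => hδ (Metric.mem_cthickening_of_dist_le x (x + y) δ _ hx ?_)
      simpa using hy⟩
  refine ⟨q, fun x => rfl, ?_⟩
  rw [testH1Norm_eq, testH1Norm_eq]
  have h1 : ∫ x, q x ^ 2 = ∫ x, w x ^ 2 := integral_add_right_eq_self (fun x => w x ^ 2) y
  have h2 : ∫ x, ‖∇ q x‖ ^ 2 = ∫ x, ‖∇ w x‖ ^ 2 := by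
    rw [← integral_add_right_eq_self (fun x => ‖∇ w x‖ ^ 2) y]
    simp_rw [← gradient_comp_add_right]
    rfl
  rw [h1, h2]

/-- Averaging over translations commutes with testing against a compactly supported function. -/
theorem integral_convolution_mul {E : Type*} [NormedAddCommGroup E] [NormedSpace ℝ E]
    [FiniteDimensional ℝ E] [MeasurableSpace E] [BorelSpace E] {μ : Measure E} [μ.IsAddHaarMeasure]
    {ρ v g : E → ℝ} (hρ : Continuous ρ) (hρc : HasCompactSupport ρ) (hv : Continuous v)
    (hg : Continuous g) (hgc : HasCompactSupport g) :
    ∫ x, (∫ y, ρ y * v (x - y) ∂μ) * g x ∂μ = ∫ y, ρ y * ∫ x, v x * g (x + y) ∂μ ∂μ := by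
  have h1 (x : E) : (∫ y, ρ y * v (x - y) ∂μ) * g x = ∫ y, ρ y * v (x - y) * g x ∂μ :=
    (integral_mul_const _ _).symm
  simp_rw [h1]
  rw [integral_integral_swap_of_hasCompactSupport]
  · refine integral_congr_ae (ae_of_all _ fun y => ?_)
    beta_reduce
    rw [← integral_sub_right_eq_self (fun x => v x * g (x + y)) y, ← integral_const_mul]
    refine integral_congr_ae (ae_of_all _ fun x => ?_)
    simp [mul_assoc]
  · fun_prop
  · refine HasCompactSupport.intro (hgc.prod hρc) ?_
    rintro ⟨x, y⟩ h
    rw [Set.mem_prod, not_and_or] at h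
    rcases h with h | h
    · simp [Function.uncurry, image_eq_zero_of_notMem_tsupport h]
    · simp [Function.uncurry, image_eq_zero_of_notMem_tsupport h]

variable {v : EuclideanSpace ℝ (Fin d) → ℝ} {M : ℝ}

/-- Mollifying `v` amounts to averaging over translates of `w`, each with the same norm; as the
mollifier has mass one, the constant `M` survives. -/
theorem abs_integral_convolution_mul_laplacian_le (hv : Continuous v)
    (hM : ∀ w : 𝓓(Ω, ℝ), |∫ x in (Ω : Set (EuclideanSpace ℝ (Fin d))), v x * (Δ (w : _ → ℝ)) x|
      ≤ M * testH1Norm Ω w)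
    (φ : ContDiffBump (0 : EuclideanSpace ℝ (Fin d))) (w : 𝓓(Ω, ℝ))
    (hφ : Metric.cthickening φ.rOut (tsupport w) ⊆ Ω) :
    |∫ x, (∫ y, φ.normed volume y * v (x - y)) * (Δ (w : _ → ℝ)) x| ≤ M * testH1Norm Ω w := by
  rw [integral_convolution_mul φ.continuous_normed φ.hasCompactSupport_normed hv
    w.contDiff_two.continuous_laplacian w.hasCompactSupport_laplacian]
  have key (y : EuclideanSpace ℝ (Fin d)) :
      ‖φ.normed volume y * ∫ x, v x * (Δ (w : _ → ℝ)) (x + y)‖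
        ≤ φ.normed volume y * (M * testH1Norm Ω w) := by
    rw [norm_mul, Real.norm_of_nonneg (φ.nonneg_normed y)]
    by_cases hy : φ.normed volume y = 0
    · simp [hy]
    have hy' : y ∈ Metric.ball (0 : EuclideanSpace ℝ (Fin d)) φ.rOut := by
      rw [← φ.support_normed_eq (μ := volume)]
      exact hy
    obtain ⟨q, hq, hqn⟩ := exists_testFunction_comp_add_right w hφ
      (mem_ball_zero_iff.1 hy').le
    refine mul_le_mul_of_nonneg_left ?_ (φ.nonneg_normed y)
    have h := hM q
    rw [hqn, setIntegral_mul_laplacian_eq_integral] at h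
    have hq' : (q : _ → ℝ) = fun x => w (x + y) := funext hq
    simp_rw [hq', laplacian_comp_add_right] at h
    exact h
  refine (norm_integral_le_of_norm_le (φ.integrable_normed.mul_const _) (ae_of_all _ key)).trans ?_
  rw [integral_mul_const, φ.integral_normed, one_mul]

theorem exists_testFunction_approx (hv : Continuous v) (hvc : HasCompactSupport v)
    (hvΩ : ∀ x ∉ Ω, v x = 0)
    (hM : ∀ w : 𝓓(Ω, ℝ), |∫ x in (Ω : Set (EuclideanSpace ℝ (Fin d))), v x * (Δ (w : _ → ℝ)) x|
      ≤ M * testH1Norm Ω w) {ε : ℝ} (hε : 0 < ε) :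
    ∃ w : 𝓓(Ω, ℝ), (∀ x, |v x - w x| ≤ 5 * ε) ∧
      ∫ x in (Ω : Set (EuclideanSpace ℝ (Fin d))), ‖∇ w x‖ ^ 2 ≤ M * testH1Norm Ω w := by
  obtain ⟨F, hF, hF0, hF1, hFt⟩ := exists_contDiff_truncation hε
  let K : Set (EuclideanSpace ℝ (Fin d)) := {x | ε / 2 ≤ |v x|}
  have hKc : IsClosed K := isClosed_le continuous_const hv.abs
  have hK : IsCompact K := hvc.of_isClosed_subset hKc fun x hx => by
    refine subset_tsupport _ fun h => ?_
    simp only [K, Set.mem_ofPred_eq, h, abs_zero] at hx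
    linarith
  have hKΩ : K ⊆ Ω := fun x hx => by
    by_contra h
    simp only [K, Set.mem_ofPred_eq, hvΩ x h, abs_zero] at hx
    linarith
  obtain ⟨δ₁, hδ₁, hKδ⟩ := hK.exists_cthickening_subset_open Ω.isOpen hKΩ
  obtain ⟨δ₂, hδ₂, hvδ⟩ := Metric.uniformContinuous_iff.1
    (hvc.uniformContinuous_of_continuous hv) (ε / 2) (by positivity)
  have hδ : 0 < min δ₁ δ₂ := lt_min hδ₁ hδ₂
  -- A radius at most `δ₁` keeps translates of the support in `Ω`; at most `δ₂`, it makes the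
  -- mollification `ε/2`-close to `v`. So off `K` the mollification is below `ε` in absolute value,
  -- where `F` vanishes.
  let φ : ContDiffBump (0 : EuclideanSpace ℝ (Fin d)) :=
    ⟨min δ₁ δ₂ / 2, min δ₁ δ₂, by positivity, by linarith⟩
  let vδ : EuclideanSpace ℝ (Fin d) → ℝ := fun x => ∫ y, φ.normed volume y * v (x - y)
  have hvδ_eq : vδ = convolution (φ.normed volume) v (ContinuousLinearMap.lsmul ℝ ℝ) volume := by
    ext x
    simp [vδ, convolution]
  have hvδ_smooth : ContDiff ℝ (⊤ : ℕ∞) vδ := by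
    rw [hvδ_eq]
    exact φ.hasCompactSupport_normed.contDiff_convolution_left _ φ.contDiff_normed
      hv.locallyIntegrable
  have hclose (x : EuclideanSpace ℝ (Fin d)) : |vδ x - v x| ≤ ε / 2 := by
    rw [hvδ_eq, ← Real.dist_eq]
    refine φ.dist_normed_convolution_le hv.aestronglyMeasurable fun y hy => ?_
    exact (hvδ (lt_of_lt_of_le hy (min_le_right _ _))).le
  have hsupp : tsupport (fun x => F (vδ x)) ⊆ K := by
    refine closure_minimal (fun x hx => ?_) hKc
    by_contra h
    refine hx (hF0 _ ?_)
    simp only [K, Set.mem_ofPred_eq, not_le] at h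
    have h1 := abs_add_le (vδ x - v x) (v x)
    rw [sub_add_cancel] at h1
    linarith [hclose x]
  let w : 𝓓(Ω, ℝ) := ⟨fun x => F (vδ x), hF.comp hvδ_smooth,
    hK.of_isClosed_subset (isClosed_tsupport _) hsupp, hsupp.trans hKΩ⟩
  have hvδ1 : ContDiff ℝ 1 vδ := hvδ_smooth.of_le (by exact_mod_cast le_top)
  have hgrad (x : EuclideanSpace ℝ (Fin d)) : ∇ w x = deriv F (vδ x) • ∇ vδ x := by
    have h1 : HasFDerivAt w (deriv F (vδ x) • fderiv ℝ vδ x) x :=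
      (hF.differentiable (by simp) (vδ x)).hasDerivAt.comp_hasFDerivAt x
        (hvδ1.differentiable (by norm_num) x).hasFDerivAt
    simp [gradient, h1.fderiv]
  refine ⟨w, fun x => ?_, ?_⟩
  · have h1 : |F (vδ x) - vδ x| ≤ 4 * ε := hFt _
    have h2 := hclose x
    change |v x - F (vδ x)| ≤ 5 * ε
    rw [abs_le] at *
    constructor <;> linarith
  · have hle : ∫ x in (Ω : Set (EuclideanSpace ℝ (Fin d))), ‖∇ w x‖ ^ 2
        ≤ ∫ x, inner ℝ (∇ vδ x) (∇ w x) := by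
      rw [setIntegral_eq_integral_of_forall_compl_eq_zero]
      · refine integral_mono_of_nonneg (ae_of_all _ fun x => sq_nonneg _) ?_
          (ae_of_all _ fun x => ?_)
        · refine (hvδ1.continuous_gradient.inner
            w.contDiff_one.continuous_gradient).integrable_of_hasCompactSupport ?_
          refine w.hasCompactSupport_gradient.mono fun x hx h => hx ?_
          simp [h]
        · beta_reduce
          rw [hgrad, norm_smul, inner_smul_right, real_inner_self_eq_norm_sq, mul_pow,
            Real.norm_eq_abs, sq_abs]
          refine mul_le_mul_of_nonneg_right ?_ (sq_nonneg _)
          -- This is `F'² ≤ F'`, from `0 ≤ F' ≤ 1`.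
          nlinarith [hF1 (vδ x)]
      · intro x hx
        rw [image_eq_zero_of_notMem_tsupport (f := ∇ w)
          fun h => hx (w.tsupport_subset (tsupport_gradient_subset _ h))]
        simp
    have hgreen := integral_mul_laplacian_eq_neg isOpen_univ hvδ1.contDiffOn w.contDiff_two
      w.hasCompactSupport (Set.subset_univ _)
    have hbound := abs_integral_convolution_mul_laplacian_le hv hM φ w
      ((Metric.cthickening_mono (min_le_left _ _) _).trans
        ((Metric.cthickening_subset_of_subset _ hsupp).trans hKδ))
    have h3 := (abs_le.1 hbound).1
    change _ ≤ ∫ x, vδ x * (Δ (w : _ → ℝ)) x at h3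
    linarith

/-- A continuous function on `closure Ω` which vanishes on the boundary and has its Laplacian in
`H⁻¹` belongs to `H¹₀`. -/
theorem exists_isH10_of_continuous (hbdd : Bornology.IsBounded (Ω : Set (EuclideanSpace ℝ (Fin d))))
    (hv : Continuous v) (hvc : HasCompactSupport v) (hvΩ : ∀ x ∉ Ω, v x = 0) (hM0 : 0 ≤ M)
    (hM : ∀ w : 𝓓(Ω, ℝ), |∫ x in (Ω : Set (EuclideanSpace ℝ (Fin d))), v x * (Δ (w : _ → ℝ)) x|
      ≤ M * testH1Norm Ω w) :
    ∃ G, IsH10 Ω v G ∧ ∀ q : 𝓓(Ω, ℝ),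
      ∫ x in (Ω : Set (EuclideanSpace ℝ (Fin d))), v x * (Δ (q : _ → ℝ)) x
        = -∫ x in (Ω : Set (EuclideanSpace ℝ (Fin d))), inner ℝ (G x) (∇ q x) := by
  have hΩ : volume (Ω : Set (EuclideanSpace ℝ (Fin d))) ≠ ⊤ := hbdd.measure_lt_top.ne
  choose w hw hwg using fun n : ℕ => exists_testFunction_approx hv hvc hvΩ hM
    (ε := 1 / ((n : ℝ) + 1)) (by positivity)
  obtain ⟨A, hA⟩ := hvc.exists_bound_of_continuous hv
  have hA0 : 0 ≤ A := (norm_nonneg _).trans (hA 0)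
  -- As `ε ≤ 1`, each `w n` is within `5` of `v`, hence bounded by `A + 5`.
  let B : ℝ := (A + 5) ^ 2 * volume.real (Ω : Set (EuclideanSpace ℝ (Fin d)))
  have hB0 : 0 ≤ B := by positivity
  have hB (n : ℕ) : ∫ x in (Ω : Set (EuclideanSpace ℝ (Fin d))), w n x ^ 2 ≤ B := by
    refine (Real.le_norm_self _).trans (norm_setIntegral_le_of_norm_le_const hΩ.lt_top
      fun x _ => ?_)
    have h1 : (1 : ℝ) / ((n : ℝ) + 1) ≤ 1 := by
      rw [div_le_one (by positivity)]
      linarith [(Nat.cast_nonneg n : (0 : ℝ) ≤ n)]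
    have h2 := abs_le.1 (hw n x)
    have h3 := abs_le.1 (hA x)
    rw [norm_pow, Real.norm_eq_abs]
    refine pow_le_pow_left₀ (abs_nonneg _) (abs_le.2 ⟨?_, ?_⟩) 2 <;> linarith
  refine exists_isH10_of_tendsto_of_bounded (w := w) (C := B + M + 1)
    ((hv.memLp_of_hasCompactSupport hvc).restrict _) ?_ fun n => ?_
  · have hlim : Tendsto (fun n : ℕ => volume (Ω : Set (EuclideanSpace ℝ (Fin d))) ^ (2 : ℝ)⁻¹
        * ENNReal.ofReal (5 * (1 / ((n : ℝ) + 1)))) atTop (𝓝 0) := by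
      have h1 : Tendsto (fun n : ℕ => ENNReal.ofReal (5 * (1 / ((n : ℝ) + 1)))) atTop (𝓝 0) := by
        simpa using ENNReal.tendsto_ofReal (tendsto_one_div_add_atTop_nhds_zero_nat.const_mul 5)
      simpa using ENNReal.Tendsto.const_mul h1
        (Or.inr (ENNReal.rpow_ne_top_of_nonneg (by norm_num) hΩ))
    refine tendsto_of_tendsto_of_tendsto_of_le_of_le tendsto_const_nhds hlim (fun _ => zero_le)
      fun n => ?_
    refine (eLpNorm_le_of_ae_bound (ae_of_all _ (hw n))).trans (le_of_eq ?_)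
    simp
  -- With `N` the `H¹` norm, `N² ≤ B + M N`; but `N > B + M + 1` would give `N² > (B + M + 1) N ≥ B
  -- + M N`.
  · by_contra! hcon
    have h1 : testH1Norm Ω (w n) ^ 2 ≤ B + M * testH1Norm Ω (w n) := by
      conv_lhs => rw [testH1Norm]
      rw [Real.sq_sqrt (by positivity)]
      exact add_le_add (hB n) (hwg n)
    nlinarith

end Mollification

/-! ### Comparison of the classical and variational solutions. -/

section Main

variable {d : ℕ} {Ω : TopologicalSpace.Opens (EuclideanSpace ℝ (Fin d))}
  {φ : C(frontier (Ω : Set (EuclideanSpace ℝ (Fin d))), ℝ)} {u Φ : EuclideanSpace ℝ (Fin d) → ℝ}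

theorem InnerProductSpace.HarmonicOnNhd.setIntegral_mul_laplacian_eq_zero
    (hu : InnerProductSpace.HarmonicOnNhd u (Ω : Set (EuclideanSpace ℝ (Fin d)))) (w : 𝓓(Ω, ℝ)) :
    ∫ x in (Ω : Set (EuclideanSpace ℝ (Fin d))), u x * (Δ (w : _ → ℝ)) x = 0 := by
  rw [setIntegral_mul_laplacian_eq_integral]
  exact integral_mul_laplacian_eq_zero_of_harmonicOnNhd Ω.isOpen hu w.contDiff_two
    w.hasCompactSupport w.tsupport_subset

theorem IsClassicalSolution.isAdmissibleExtension (hu : IsClassicalSolution Ω φ u) :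
    IsAdmissibleExtension Ω φ u :=
  ⟨hu.continuousOn, hu.boundary, 0, le_rfl, fun w => by
    simp [hu.harmonic.setIntegral_mul_laplacian_eq_zero w]⟩

theorem IsClassicalSolution.isVariationalSolutionFrom
    (hbdd : Bornology.IsBounded (Ω : Set (EuclideanSpace ℝ (Fin d))))
    (hu : IsClassicalSolution Ω φ u) (hΦ : IsAdmissibleExtension Ω φ Φ) :
    IsVariationalSolutionFrom Ω Φ u := by
  -- The values of `Φ` and `u` outside the closure are arbitrary; cutting off at the boundary, where
  -- they agree, gives a continuous function on the whole space.
  let v := (Ω : Set (EuclideanSpace ℝ (Fin d))).indicator fun x => Φ x - u x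
  have hv : Continuous v := by
    refine continuous_indicator (fun x hx => ?_) (hΦ.continuousOn.sub hu.continuousOn)
    have h1 := hΦ.boundary ⟨x, hx⟩
    have h2 := hu.boundary ⟨x, hx⟩
    rw [h1, h2, sub_self]
  have hvΩ : ∀ x ∉ Ω, v x = 0 := fun x hx => Set.indicator_of_notMem hx _
  have hvc : HasCompactSupport v :=
    HasCompactSupport.intro hbdd.isCompact_closure fun x hx => hvΩ x fun h => hx (subset_closure h)
  have hlap (w : 𝓓(Ω, ℝ)) :
      ∫ x in (Ω : Set (EuclideanSpace ℝ (Fin d))), v x * (Δ (w : _ → ℝ)) x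
        = ∫ x in (Ω : Set (EuclideanSpace ℝ (Fin d))), Φ x * (Δ (w : _ → ℝ)) x := by
    have hint {f : EuclideanSpace ℝ (Fin d) → ℝ}
        (hf : ContinuousOn f (closure (Ω : Set (EuclideanSpace ℝ (Fin d))))) :
        IntegrableOn (fun x => f x * (Δ (w : _ → ℝ)) x) Ω :=
      ((hf.mono subset_closure).integrable_mul_of_tsupport_subset Ω.isOpen
        w.contDiff_two.continuous_laplacian w.hasCompactSupport_laplacian
        ((tsupport_laplacian_subset _).trans w.tsupport_subset)).integrableOn
    have h1 : ∫ x in (Ω : Set (EuclideanSpace ℝ (Fin d))), v x * (Δ (w : _ → ℝ)) x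
        = ∫ x in (Ω : Set (EuclideanSpace ℝ (Fin d))),
          (Φ x * (Δ (w : _ → ℝ)) x - u x * (Δ (w : _ → ℝ)) x) := by
      refine setIntegral_congr_fun Ω.isOpen.measurableSet fun x hx => ?_
      simp only [v, Set.indicator_of_mem hx, sub_mul]
    rw [h1, integral_sub (hint hΦ.continuousOn) (hint hu.continuousOn),
      hu.harmonic.setIntegral_mul_laplacian_eq_zero w, sub_zero]
  obtain ⟨M, hM0, hM⟩ := hΦ.laplacian
  obtain ⟨G, hG, hGq⟩ := exists_isH10_of_continuous hbdd hv hvc hvΩ hM0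
    (fun w => by rw [hlap]; exact hM w)
  refine ⟨hu.harmonic, v, G, hG, fun w => by rw [← hlap, hGq], ?_⟩
  filter_upwards [ae_restrict_mem Ω.isOpen.measurableSet] with x hx
  simp [v, Set.indicator_of_mem hx]

theorem IsVariationalSolutionFrom.eqOn (hd : 0 < d)
    (hbdd : Bornology.IsBounded (Ω : Set (EuclideanSpace ℝ (Fin d))))
    {h h' : EuclideanSpace ℝ (Fin d) → ℝ} (hh : IsVariationalSolutionFrom Ω Φ h)
    (hh' : IsVariationalSolutionFrom Ω Φ h') :
    Set.EqOn h h' (Ω : Set (EuclideanSpace ℝ (Fin d))) := by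
  obtain ⟨hharm, v, G, hG, hw, hae⟩ := hh
  obtain ⟨hharm', v', G', hG', hw', hae'⟩ := hh'
  have hvv := hG.ae_eq_of_forall_integral_inner_eq hd hbdd hG'
    fun q => neg_injective ((hw q).symm.trans (hw' q))
  -- Harmonic functions are continuous, so equality almost everywhere on the open set becomes
  -- equality everywhere.
  refine Measure.eqOn_open_of_ae_eq (μ := volume) ?_ Ω.isOpen hharm.continuousOn
    hharm'.continuousOn
  filter_upwards [hvv, hae, hae'] with x h1 h2 h3
  rw [h2, h3, h1]

end Main

/-- If `D(φ)` has a classical solution `u`, then `u` is a variational solution of `D(φ)`, it is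
produced by every admissible extension of `φ`, and it is the only variational solution: every
variational solution of `D(φ)` coincides with `u` on `Ω`. -/
theorem proposition2p3 (d : ℕ) (hd : 2 ≤ d)
    (Ω : TopologicalSpace.Opens (EuclideanSpace ℝ (Fin d)))
    (hconn : IsConnected (Ω : Set (EuclideanSpace ℝ (Fin d))))
    (hbdd : Bornology.IsBounded (Ω : Set (EuclideanSpace ℝ (Fin d))))
    (φ : C(frontier (Ω : Set (EuclideanSpace ℝ (Fin d))), ℝ))
    (u : EuclideanSpace ℝ (Fin d) → ℝ)
    (hu : IsClassicalSolution Ω φ u) :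
    IsVariationalSolution Ω φ u ∧
    (∀ Φ : EuclideanSpace ℝ (Fin d) → ℝ,
      IsAdmissibleExtension Ω φ Φ → IsVariationalSolutionFrom Ω Φ u) ∧
    ∀ h : EuclideanSpace ℝ (Fin d) → ℝ, IsVariationalSolution Ω φ h →
      Set.EqOn u h (Ω : Set (EuclideanSpace ℝ (Fin d))) := by
  refine ⟨⟨u, hu.isAdmissibleExtension,
    hu.isVariationalSolutionFrom hbdd hu.isAdmissibleExtension⟩,
    fun Φ hΦ => hu.isVariationalSolutionFrom hbdd hΦ, ?_⟩
  rintro h ⟨Φ, hΦ, hh⟩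
  -- No comparison of different extensions is needed: `u` is produced by the very `Φ` that produced
  -- `h`.
  exact (hu.isVariationalSolutionFrom hbdd hΦ).eqOn (by lia) hbdd hh
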